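/- Let $B_m$ denote the $m$-th Bernoulli number, defined by $\frac{x}{e^x-1}=\sum_{m\ge 0}B_m\frac{x^m}{m!}$. Then for every integer $n\ge 0$ (where a $0\times 0$ determinant and an empty product are equal to $1$), \begin{align*} \det_{0\le i,j\le n-1}\left[\frac{B_{2i+2j+2}}{(2i+2j+2)!}\right] &=4^{-n^2}\prod_{i=1}^{2n-1}(2i+1)^{-(2n-i)},\\ \det_{0\le i,j\le n-1}\left[\frac{B_{2i+2j+4}}{(2i+2j+4)!}\right] &=(-1)^n\,4^{-n^2-n}\,9^{-n}\prod_{i=1}^{2n-1}(2i+3)^{-(2n-i)},\\ \det_{0\le i,j\le n-1}\left[\frac{B_{2i+2j+6}}{(2i+2j+6)!}\right] &=4^{-n^2-2n}\,(n+1)(2n+3)\prod_{i=1}^{2n+1}(2i+1)^{-(2n+2-i)}. \end{align*} -/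

import Mathlib

open Finset

/-! With t = x², the even part of x/(e^x - 1) is (x/2) coth(x/2) = F₀/F₁, where F_m = `besselSeries
m`. The contiguous relation F_m = F_{m+1} + c_m t F_{m+2} makes Q_m = F_{m+1}/F_m satisfy Q_m = 1/(1
+ c_m t Q_{m+1}), and F₀/F₁ = 1 + c₀ t Q₁. Hankel determinants of reciprocal series are related by
unitriangular Toeplitz factors, so each level of this continued fraction trades shift 0 for shift 1
and back (`besselHankel_one`, `besselHankel_zero_succ`). The ratio of determinants of consecutive
sizes is then a product of the -c_i, which settles the first two formulas. The third follows from
them by Desnanot–Jacobi condensation (`bernoulliHankel_three_eq`). -/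

/-! ### Hankel determinants of reciprocal power series -/

/-- The `n × n` Hankel matrix of a sequence. -/
def hankelMatrix {R : Type*} (s : ℕ → R) (n : ℕ) : Matrix (Fin n) (Fin n) R :=
  Matrix.of fun i j => s (i + j)

/-- The lower triangular Toeplitz matrix of a sequence. -/
def lowerToeplitz {R : Type*} [Zero R] (s : ℕ → R) (n : ℕ) : Matrix (Fin n) (Fin n) R :=
  Matrix.of fun i j => if (j : ℕ) ≤ i then s (i - j) else 0

theorem det_lowerToeplitz {R : Type*} [CommRing R] (s : ℕ → R) (n : ℕ) :
    (lowerToeplitz s n).det = s 0 ^ n := by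
  rw [Matrix.det_of_isLowerTriangular]
  · simp [lowerToeplitz]
  · intro i j hij
    exact if_neg (Nat.not_le.mpr hij)

theorem det_hankelMatrix_const_mul {R : Type*} [CommRing R] (c : R) (s : ℕ → R) (n : ℕ) :
    (hankelMatrix (fun k => c * s k) n).det = c ^ n * (hankelMatrix s n).det := by
  have : hankelMatrix (fun k => c * s k) n = c • hankelMatrix s n := by
    ext i j; simp [hankelMatrix]
  rw [this, Matrix.det_smul, Fintype.card_fin]

theorem sum_fin_ite_le {R : Type*} [AddCommMonoid R] {n : ℕ} (i : Fin n) (f : ℕ → R) :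
    ∑ l : Fin n, (if (l : ℕ) ≤ i then f l else 0) = ∑ l ∈ range (i + 1), f l := by
  rw [Fin.sum_univ_eq_sum_range (fun l => if l ≤ (i : ℕ) then f l else 0), ← sum_filter]
  congr 1
  ext l
  simp only [mem_filter, mem_range]
  have := i.2
  omega

theorem lowerToeplitz_mul_apply {R : Type*} [CommRing R] (a : ℕ → R) {n : ℕ}
    (s : ℕ → ℕ → R) (i k : Fin n) :
    (lowerToeplitz a n * Matrix.of fun i j : Fin n => s i j) i k
      = ∑ l ∈ range (i + 1), a (i - l) * s l k := by
  rw [← sum_fin_ite_le]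
  simp [Matrix.mul_apply, lowerToeplitz, ite_mul]

theorem mul_transpose_lowerToeplitz_apply {R : Type*} [CommRing R] (f : ℕ → R) {n : ℕ}
    (s : ℕ → ℕ → R) (i k : Fin n) :
    ((Matrix.of fun i j : Fin n => s i j) * (lowerToeplitz f n).transpose) i k
      = ∑ l ∈ range (k + 1), f (k - l) * s i l := by
  rw [← sum_fin_ite_le]
  simp [Matrix.mul_apply, lowerToeplitz, mul_ite, mul_comm]

/-- The hypothesis is the matrix identity L_a S = T L_fᵀ read entrywise, and both Toeplitz factors
are unitriangular. -/
theorem det_eq_of_lowerToeplitz_mul {R : Type*} [CommRing R] {a f : ℕ → R} (ha : a 0 = 1)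
    (hf : f 0 = 1) {n : ℕ} {s t : ℕ → ℕ → R}
    (h : ∀ i k, ∑ l ∈ range (i + 1), a (i - l) * s l k
      = ∑ l ∈ range (k + 1), f (k - l) * t i l) :
    (Matrix.of fun i j : Fin n => s i j).det = (Matrix.of fun i j : Fin n => t i j).det := by
  have key : lowerToeplitz a n * (Matrix.of fun i j : Fin n => s i j)
      = (Matrix.of fun i j : Fin n => t i j) * (lowerToeplitz f n).transpose := by
    ext i k
    rw [lowerToeplitz_mul_apply, mul_transpose_lowerToeplitz_apply, h]
  simpa [det_lowerToeplitz, ha, hf] using congrArg Matrix.det key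

/-- The coefficient of degree i + k in the product is cut at index k. When it vanishes, the upper
part, an entry of Toeplitz times Hankel, is minus the lower part. -/
theorem sum_range_split_convolution {R : Type*} [CommRing R] (a f : ℕ → R) (i k : ℕ) :
    ∑ l ∈ range (i + 1), a (i - l) * f (l + k) + ∑ l ∈ range k, a (i + k - l) * f l
      = ∑ l ∈ range (i + k + 1), a (i + k - l) * f l := by
  rw [show i + k + 1 = k + (i + 1) by ring, sum_range_add _ k, add_comm (∑ l ∈ range (i + 1), _)]
  refine congrArg _ (sum_congr rfl fun l _ => ?_)
  rw [add_comm l k, show i + k - (k + l) = i - l by omega]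

section Reciprocal

variable {R : Type*} [CommRing R] {a f : ℕ → R}

/-- If `a` and `f` are the coefficients of reciprocal power series, the Hankel determinant
of the shift of `f` is that of the shift of `-a`. -/
theorem det_hankelMatrix_succ_of_reciprocal (ha : a 0 = 1) (hf : f 0 = 1)
    (h : ∀ n, ∑ l ∈ range (n + 2), a (n + 1 - l) * f l = 0) (n : ℕ) :
    (hankelMatrix (fun k => f (k + 1)) n).det = (hankelMatrix (fun k => -a (k + 1)) n).det := by
  refine det_eq_of_lowerToeplitz_mul (s := fun i j => f (i + j + 1))
    (t := fun i j => -a (i + j + 1)) ha hf fun i k => ?_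
  have h1 := sum_range_split_convolution a f i (k + 1)
  rw [show i + (k + 1) + 1 = i + k + 2 by ring, show i + (k + 1) = i + k + 1 by ring, h] at h1
  rw [← sum_range_reflect (fun l => f (k - l) * -a (i + l + 1))]
  simp only [add_assoc] at h1 ⊢
  rw [eq_neg_of_add_eq_zero_left h1, ← sum_neg_distrib]
  refine sum_congr rfl fun l hl => ?_
  rw [mem_range] at hl
  rw [show k - (k + 1 - 1 - l) = l by omega,
    show i + (k + 1 - 1 - l + 1) = i + (k + 1) - l by omega]
  ring

/-- If `a` and `f` are the coefficients of reciprocal power series, the Hankel determinant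
of `f` is that of the double shift of `-a` in one size less. -/
theorem det_hankelMatrix_of_reciprocal (ha : a 0 = 1) (hf : f 0 = 1)
    (h : ∀ n, ∑ l ∈ range (n + 2), a (n + 1 - l) * f l = 0) (n : ℕ) :
    (hankelMatrix f (n + 1)).det = (hankelMatrix (fun k => -a (k + 2)) n).det := by
  -- The comparison matrix is the direct sum of 1 and (-a (i + j)) for i, j ≥ 1; renumbering the
  -- second block from 0 produces the double shift.
  have h0 : (hankelMatrix f (n + 1)).det = (Matrix.of fun i j : Fin (n + 1) =>
      (fun i j : ℕ => if i = 0 then (if j = 0 then 1 else 0)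
        else if j = 0 then 0 else -a (i + j)) i j).det := by
    refine det_eq_of_lowerToeplitz_mul (s := fun i j => f (i + j))
      (t := fun i j => if i = 0 then (if j = 0 then 1 else 0)
        else if j = 0 then 0 else -a (i + j)) ha hf fun i k => ?_
    rcases Nat.eq_zero_or_pos i with rfl | hi
    · simp [ha]
    · have h1 := sum_range_split_convolution a f i k
      obtain ⟨i, rfl⟩ : ∃ j, i = j + 1 := ⟨i - 1, by omega⟩
      rw [show i + 1 + k + 1 = i + k + 2 by ring, show i + 1 + k = i + k + 1 by ring, h] at h1
      rw [eq_neg_of_add_eq_zero_left h1, sum_range_succ',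
        ← sum_range_reflect (fun l => f (k - (l + 1)) * _), ← sum_neg_distrib]
      simp only [Nat.add_eq_zero_iff, one_ne_zero, and_false, if_false, if_true, mul_zero, add_zero]
      refine sum_congr rfl fun l hl => ?_
      rw [mem_range] at hl
      rw [show k - (k - 1 - l + 1) = l by omega,
        show i + 1 + (k - 1 - l + 1) = i + k + 1 - l by omega]
      ring
  rw [h0, Matrix.det_succ_row_zero, sum_eq_single 0]
  · simp only [Matrix.of_apply, Fin.val_zero, if_true, pow_zero, one_mul, Fin.succAbove_zero]
    congr 1
    ext i j
    simp only [hankelMatrix, Matrix.submatrix_apply, Matrix.of_apply, Fin.val_succ,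
      Nat.add_eq_zero_iff, one_ne_zero, and_false, if_false]
    congr 2
    ring
  · intro j _ hj
    simp [hj]
  · simp

end Reciprocal

/-! ### Desnanot–Jacobi condensation -/

/-- Jacobi's identity for a complementary minor of the inverse. -/
theorem det_mul_det_inv_toBlocks₁₁ {K ι κ : Type*} [Field K] [Fintype ι] [DecidableEq ι]
    [Fintype κ] [DecidableEq κ] (M : Matrix (ι ⊕ κ) (ι ⊕ κ) K) (hM : M.det ≠ 0) :
    M.det * M⁻¹.toBlocks₁₁.det = M.toBlocks₂₂.det := by
  have h1 : M * M⁻¹ = 1 := Matrix.mul_nonsing_inv _ hM.isUnit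
  -- The second block column of M⁻¹ is replaced by that of the identity, so both sides are block
  -- triangular.
  have key : M * Matrix.fromBlocks M⁻¹.toBlocks₁₁ 0 M⁻¹.toBlocks₂₁ 1
      = Matrix.fromBlocks 1 M.toBlocks₁₂ 0 M.toBlocks₂₂ := by
    generalize M⁻¹ = N at h1 ⊢
    obtain ⟨P, Q, S, T, rfl⟩ : ∃ P Q S T, M = Matrix.fromBlocks P Q S T :=
      ⟨_, _, _, _, (Matrix.fromBlocks_toBlocks M).symm⟩
    obtain ⟨P', Q', S', T', rfl⟩ : ∃ P Q S T, N = Matrix.fromBlocks P Q S T :=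
      ⟨_, _, _, _, (Matrix.fromBlocks_toBlocks N).symm⟩
    rw [Matrix.fromBlocks_multiply, ← Matrix.fromBlocks_one, Matrix.fromBlocks_inj] at h1
    simp [Matrix.fromBlocks_multiply, h1.1, h1.2.2.1]
  simpa [Matrix.det_fromBlocks_zero₁₂, Matrix.det_fromBlocks_zero₂₁] using congrArg Matrix.det key

/-- The embedding of two end points and the interior into `Fin (n + 2)`. -/
noncomputable def finEndsEquiv (n : ℕ) : Fin 2 ⊕ Fin n ≃ Fin (n + 2) :=
  Equiv.ofBijective (Sum.elim ![0, Fin.last (n + 1)] fun i => i.castSucc.succ) <| by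
    rw [Fintype.bijective_iff_injective_and_card]
    refine ⟨?_, by simp [add_comm]⟩
    rintro (i | i) (j | j) h
    · fin_cases i <;> fin_cases j <;> simp [Fin.ext_iff] at h ⊢
    · have := j.2
      fin_cases i <;> simp [Fin.ext_iff] at h
      omega
    · have := i.2
      fin_cases j <;> simp [Fin.ext_iff] at h
      omega
    · simpa [Fin.ext_iff] using h

/-- The Desnanot–Jacobi identity. -/
theorem desnanot_jacobi {K : Type*} [Field K] {n : ℕ} (A : Matrix (Fin (n + 2)) (Fin (n + 2)) K)
    (hA : A.det ≠ 0) :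
    A.det * (A.submatrix (fun i : Fin n => i.castSucc.succ) fun i : Fin n => i.castSucc.succ).det
      = (A.submatrix Fin.succ Fin.succ).det * (A.submatrix Fin.castSucc Fin.castSucc).det
        - (A.submatrix Fin.succ Fin.castSucc).det * (A.submatrix Fin.castSucc Fin.succ).det := by
  have h := det_mul_det_inv_toBlocks₁₁ (A.submatrix (finEndsEquiv n) (finEndsEquiv n))
    (by rwa [Matrix.det_submatrix_equiv_self])
  have h22 : (A.submatrix (finEndsEquiv n) (finEndsEquiv n)).toBlocks₂₂
      = A.submatrix (fun i : Fin n => i.castSucc.succ) fun i : Fin n => i.castSucc.succ := rfl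
  rw [h22, Matrix.inv_submatrix_equiv, Matrix.det_submatrix_equiv_self, Matrix.det_fin_two] at h
  have e0 : finEndsEquiv n (Sum.inl 0) = 0 := rfl
  have e1 : finEndsEquiv n (Sum.inl 1) = Fin.last (n + 1) := rfl
  -- The corner entries of the inverse are signed corner minors of A divided by `A.det`.
  simp only [Matrix.toBlocks₁₁, Matrix.of_apply, Matrix.submatrix_apply, e0, e1,
    Matrix.inv_def, Matrix.smul_apply, Ring.inverse_eq_inv', smul_eq_mul,
    Matrix.adjugate_fin_succ_eq_det_submatrix, Fin.succAbove_zero, Fin.succAbove_last,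
    Fin.val_zero, Fin.val_last] at h
  rw [← h]
  field_simp
  have hs : ((-1 : K) ^ (n + 1)) ^ 2 = 1 := by rw [← pow_mul, mul_comm, pow_mul]; simp
  have hs2 : (-1 : K) ^ (n + 1 + (n + 1)) = 1 := by rw [← two_mul, pow_mul]; simp
  simp only [zero_add, add_zero, hs2, pow_zero, one_mul]
  linear_combination (-(A.submatrix Fin.succ Fin.castSucc).det * (A.submatrix Fin.castSucc Fin.succ).det) * hs

theorem hankelMatrix_condensation {K : Type*} [Field K] (s : ℕ → K) (n : ℕ)
    (h : (hankelMatrix s (n + 2)).det ≠ 0) :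
    (hankelMatrix s (n + 2)).det * (hankelMatrix (fun k => s (k + 2)) n).det
      = (hankelMatrix s (n + 1)).det * (hankelMatrix (fun k => s (k + 2)) (n + 1)).det
        - (hankelMatrix (fun k => s (k + 1)) (n + 1)).det ^ 2 := by
  have h1 := desnanot_jacobi _ h
  have e1 : (hankelMatrix s (n + 2)).submatrix (fun i : Fin n => i.castSucc.succ)
      (fun i : Fin n => i.castSucc.succ) = hankelMatrix (fun k => s (k + 2)) n := by
    ext i j; simp [hankelMatrix]; congr 1; omega
  have e2 : (hankelMatrix s (n + 2)).submatrix Fin.succ Fin.succ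
      = hankelMatrix (fun k => s (k + 2)) (n + 1) := by
    ext i j; simp [hankelMatrix]; congr 1; omega
  have e3 : (hankelMatrix s (n + 2)).submatrix Fin.castSucc Fin.castSucc
      = hankelMatrix s (n + 1) := by
    ext i j; simp [hankelMatrix]
  have e4 : (hankelMatrix s (n + 2)).submatrix Fin.succ Fin.castSucc
      = hankelMatrix (fun k => s (k + 1)) (n + 1) := by
    ext i j; simp [hankelMatrix]; congr 1; omega
  have e5 : (hankelMatrix s (n + 2)).submatrix Fin.castSucc Fin.succ
      = hankelMatrix (fun k => s (k + 1)) (n + 1) := by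
    ext i j; simp [hankelMatrix]; congr 1
  rw [e1, e2, e3, e4, e5] at h1
  rw [h1]; ring

/-! ### The Gauss continued fraction -/

open PowerSeries in
/-- The hypergeometric series `₀F₁(; m + 1/2; t / 16)`, so that `m = 0` and `m = 1` give
`cosh (√t / 2)` and `sinh (√t / 2) / (√t / 2)`. -/
noncomputable def besselSeries (m : ℕ) : PowerSeries ℚ :=
  .mk fun k => (8 ^ k * (k.factorial : ℚ) * ∏ i ∈ range k, (2 * (m : ℚ) + 2 * i + 1))⁻¹

/-- The coefficients of the Gauss continued fraction of `besselSeries`. -/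
def besselRatio (m : ℕ) : ℚ := (4 * (2 * (m : ℚ) + 1) * (2 * m + 3))⁻¹

theorem prod_bessel_ne_zero (m k : ℕ) : ∏ i ∈ range k, (2 * (m : ℚ) + 2 * i + 1) ≠ 0 :=
  prod_ne_zero_iff.mpr fun i _ => by positivity

theorem prod_bessel_succ (m k : ℕ) : ∏ i ∈ range (k + 1), (2 * (m : ℚ) + 2 * i + 1)
    = (2 * m + 1) * ∏ i ∈ range k, (2 * ((m + 1 : ℕ) : ℚ) + 2 * i + 1) := by
  rw [prod_range_succ', mul_comm]
  congr 1
  · simp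
  · refine prod_congr rfl fun i _ => ?_
    push_cast; ring

-- In degree k + 1 this reduces to 1/(2m+1) - 1/(2m+2k+3) = 2(k+1)/((2m+1)(2m+2k+3)).
open PowerSeries in
theorem besselSeries_contiguous (m : ℕ) :
    besselSeries m = besselSeries (m + 1)
      + C (besselRatio m) * (X * besselSeries (m + 2)) := by
  ext k
  rcases k with _ | k
  · simp [besselSeries]
  · rw [map_add, coeff_C_mul, coeff_succ_X_mul]
    simp only [besselSeries, coeff_mk, besselRatio]
    have h1 := prod_bessel_ne_zero (m + 1) k
    have h2 := prod_bessel_ne_zero (m + 2) k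
    have h3 : (2 * (m : ℚ) + 1) ≠ 0 := by positivity
    have h4 : (2 * (m : ℚ) + 3) ≠ 0 := by positivity
    have h5 : (2 * (m : ℚ) + 3) * ∏ i ∈ range k, (2 * ((m + 2 : ℕ) : ℚ) + 2 * i + 1)
        = (∏ i ∈ range k, (2 * ((m + 1 : ℕ) : ℚ) + 2 * i + 1)) * (2 * m + 2 * k + 3) := by
      have := prod_bessel_succ (m + 1) k
      rw [prod_range_succ] at this
      push_cast at this ⊢
      simp only [add_assoc, one_add_one_eq_two] at this ⊢
      linear_combination -this
    have h6 : ∏ i ∈ range (k + 1), (2 * ((m + 1 : ℕ) : ℚ) + 2 * i + 1)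
      = (∏ i ∈ range k, (2 * ((m + 1 : ℕ) : ℚ) + 2 * i + 1)) * (2 * m + 2 * k + 3) := by
      rw [prod_range_succ]; push_cast; ring
    have h7 : (2 * (m : ℚ) + 2 * k + 3) ≠ 0 := by positivity
    have h8 : ∏ i ∈ range k, (2 * ((m + 2 : ℕ) : ℚ) + 2 * i + 1)
        = (∏ i ∈ range k, (2 * ((m + 1 : ℕ) : ℚ) + 2 * i + 1)) * (2 * m + 2 * k + 3)
          / (2 * (m : ℚ) + 3) := by
      rw [← h5]; field_simp
    rw [prod_bessel_succ m k, h6, h8, Nat.factorial_succ, pow_succ]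
    generalize ∏ i ∈ range k, (2 * ((m + 1 : ℕ) : ℚ) + 2 * i + 1) = P at *
    have := Nat.factorial_ne_zero k
    push_cast
    field_simp
    ring

open PowerSeries in
theorem constantCoeff_besselSeries (m : ℕ) : constantCoeff (besselSeries m) = 1 := by
  rw [← coeff_zero_eq_constantCoeff_apply]; simp [besselSeries]

open PowerSeries in
theorem besselSeries_mul_inv (m : ℕ) : besselSeries m * (besselSeries m)⁻¹ = 1 :=
  PowerSeries.mul_inv_cancel _ (by simp [constantCoeff_besselSeries])

/-- The power series expanded by the tail of the Gauss continued fraction. -/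
noncomputable def besselQuotient (m : ℕ) : PowerSeries ℚ :=
  besselSeries (m + 1) * (besselSeries m)⁻¹

open PowerSeries in
theorem besselQuotient_recip (m : ℕ) :
    (1 + C (besselRatio m) * (X * besselQuotient (m + 1))) * besselQuotient m = 1 := by
  have h0 := besselSeries_mul_inv m
  have h1 := besselSeries_mul_inv (m + 1)
  have h := besselSeries_contiguous m
  rw [besselQuotient, besselQuotient]
  linear_combination h0 - (besselSeries m)⁻¹ * h
    + C (besselRatio m) * X * besselSeries (m + 2) * (besselSeries m)⁻¹ * h1

open PowerSeries in
theorem coeff_zero_besselQuotient (m : ℕ) : coeff 0 (besselQuotient m) = 1 := by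
  simp [besselQuotient, constantCoeff_besselSeries]

/-! ### Even Bernoulli numbers as a quotient of Bessel-type series -/

theorem sum_range_two_mul_pairs {R : Type*} [AddCommMonoid R] (f : ℕ → R) (n : ℕ) :
    ∑ k ∈ range (2 * n), f k = ∑ k ∈ range n, (f (2 * k) + f (2 * k + 1)) := by
  induction n with
  | zero => simp
  | succ n ih => rw [mul_add, mul_one, sum_range_succ, sum_range_succ, ih, sum_range_succ, add_assoc]

open PowerSeries in
/-- `B(x) + x / 2` times `2 sinh (x / 2)` is `x cosh (x / 2)`. -/
theorem bernoulliPowerSeries_sinh :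
    (bernoulliPowerSeries ℚ + C (1 / 2) * X)
        * (rescale (1 / 2) (exp ℚ) - rescale (-1 / 2) (exp ℚ))
      = C (1 / 2) * X * (rescale (1 / 2) (exp ℚ) + rescale (-1 / 2) (exp ℚ)) := by
  have h := bernoulliPowerSeries_mul_exp_sub_one ℚ
  have h1 : rescale (-1 / 2) (exp ℚ) * exp ℚ = rescale (1 / 2) (exp ℚ) := by
    have := exp_mul_exp_eq_exp_add (A := ℚ) (-1 / 2) 1
    norm_num [rescale_one] at this ⊢
    exact this
  have h2 : (C (1 / 2) * X + C (1 / 2) * X : PowerSeries ℚ) = X := by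
    rw [← add_mul, ← map_add]; norm_num
  -- Multiply B(x)(e^x - 1) = x by e^(-x/2), then add (x/2)(e^(x/2) - e^(-x/2)).
  linear_combination rescale (-1 / 2) (exp ℚ) * h - bernoulliPowerSeries ℚ * h1
    - rescale (-1 / 2) (exp ℚ) * h2

/-- The coefficients of the even part of `x / (exp x - 1)`. -/
noncomputable def evenBernoulli (k : ℕ) : ℚ := bernoulli (2 * k) / (2 * k).factorial

open PowerSeries in
theorem sum_evenBernoulli (n : ℕ) :
    ∑ k ∈ range (n + 1), evenBernoulli k * (4 ^ (n - k) * ((2 * (n - k) + 1).factorial : ℚ))⁻¹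
      = (4 ^ n * ((2 * n).factorial : ℚ))⁻¹ := by
  have h := congrArg (coeff (2 * n + 1)) bernoulliPowerSeries_sinh
  rw [coeff_mul, Nat.sum_antidiagonal_eq_sum_range_succ_mk,
    show (2 * n + 1).succ = 2 * (n + 1) by omega, sum_range_two_mul_pairs, mul_assoc, coeff_C_mul,
    coeff_succ_X_mul] at h
  -- The term x/2 cancels B₁x, the only odd term of the Bernoulli series.
  have e1 : ∀ k, coeff (2 * k + 1) (bernoulliPowerSeries ℚ + C (1 / 2) * X) = 0 := by
    intro k
    rcases Nat.eq_zero_or_pos k with rfl | hk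
    · simp [bernoulliPowerSeries, bernoulli_one]; norm_num
    · simp [bernoulliPowerSeries, coeff_C, bernoulli_eq_zero_of_odd (odd_two_mul_add_one k) (by omega),
        hk.ne']
  have e2 : ∀ k, coeff (2 * k) (bernoulliPowerSeries ℚ + C (1 / 2) * X) = evenBernoulli k := by
    intro k
    have : 2 * k ≠ 1 := by omega
    simp [bernoulliPowerSeries, coeff_X, evenBernoulli, this]
  simp only [e1, e2, zero_mul, add_zero] at h
  have e3 : ∀ k ∈ range (n + 1), evenBernoulli k * coeff (2 * n + 1 - 2 * k)
      (rescale (1 / 2) (exp ℚ) - rescale (-1 / 2) (exp ℚ))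
      = evenBernoulli k * (4 ^ (n - k) * ((2 * (n - k) + 1).factorial : ℚ))⁻¹ := by
    intro k hk
    rw [mem_range] at hk
    rw [show 2 * n + 1 - 2 * k = 2 * (n - k) + 1 by omega]
    generalize n - k = m
    congr 1
    rw [map_sub, coeff_rescale, coeff_rescale, coeff_exp, neg_div, (odd_two_mul_add_one m).neg_pow,
      pow_succ, pow_mul]
    have := Nat.factorial_ne_zero (2 * m + 1)
    simp
    norm_num
    ring
  rw [sum_congr rfl e3] at h
  rw [h, map_add, coeff_rescale, coeff_rescale, coeff_exp, neg_div, (even_two_mul n).neg_pow, pow_mul]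
  simp
  norm_num
  ring

theorem besselSeries_zero_denom (k : ℕ) :
    8 ^ k * (k.factorial : ℚ) * ∏ i ∈ range k, (2 * ((0 : ℕ) : ℚ) + 2 * i + 1)
      = 4 ^ k * ((2 * k).factorial : ℚ) := by
  induction k with
  | zero => simp
  | succ k ih =>
    rw [prod_range_succ, mul_add 2 k 1, mul_one 2, Nat.factorial_succ, Nat.factorial_succ (2 * k + 1),
      Nat.factorial_succ (2 * k), pow_succ, pow_succ]
    push_cast at ih ⊢
    linear_combination 8 * ((k : ℚ) + 1) * (2 * k + 1) * ih

theorem besselSeries_one_denom (k : ℕ) :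
    8 ^ k * (k.factorial : ℚ) * ∏ i ∈ range k, (2 * ((1 : ℕ) : ℚ) + 2 * i + 1)
      = 4 ^ k * ((2 * k + 1).factorial : ℚ) := by
  induction k with
  | zero => simp
  | succ k ih =>
    rw [prod_range_succ, mul_add 2 k 1, mul_one 2, Nat.factorial_succ, Nat.factorial_succ (2 * k + 1 + 1),
      Nat.factorial_succ (2 * k + 1), pow_succ, pow_succ]
    push_cast at ih ⊢
    linear_combination 8 * ((k : ℚ) + 1) * (2 * k + 3) * ih

open PowerSeries in
theorem mk_evenBernoulli_mul :
    PowerSeries.mk evenBernoulli * besselSeries 1 = besselSeries 0 := by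
  ext n
  rw [coeff_mul, Nat.sum_antidiagonal_eq_sum_range_succ_mk]
  simp only [besselSeries, coeff_mk, besselSeries_zero_denom, besselSeries_one_denom]
  exact sum_evenBernoulli n

-- Dividing the contiguous relation at m = 0 by F₁ gives F₀/F₁ = 1 + c₀ t Q₁, with c₀ = 1/12.
open PowerSeries in
theorem evenBernoulli_succ (k : ℕ) :
    evenBernoulli (k + 1) = 1 / 12 * coeff k (besselQuotient 1) := by
  have h : PowerSeries.mk evenBernoulli = 1 + C (besselRatio 0) * (X * besselQuotient 1) := by
    have h0 := besselSeries_mul_inv 1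
    have h1 := mk_evenBernoulli_mul
    have h2 := besselSeries_contiguous 0
    rw [besselQuotient]
    simp only [zero_add, one_add_one_eq_two] at h2 ⊢
    linear_combination (1 - PowerSeries.mk evenBernoulli) * h0
      + (besselSeries 1)⁻¹ * h1 + (besselSeries 1)⁻¹ * h2
  have := congrArg (coeff (k + 1)) h
  rw [coeff_mk, map_add, coeff_C_mul, coeff_succ_X_mul, coeff_one] at this
  rw [this]
  norm_num [besselRatio]

/-! ### Hankel determinants along the continued fraction -/

open PowerSeries in
theorem coeff_besselQuotient_recip (m n : ℕ) :
    ∑ l ∈ range (n + 2), coeff (n + 1 - l) (1 + C (besselRatio m) * (X * besselQuotient (m + 1)))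
      * coeff l (besselQuotient m) = 0 := by
  have h := congrArg (coeff (n + 1)) (besselQuotient_recip m)
  rw [mul_comm, coeff_mul, Nat.sum_antidiagonal_eq_sum_range_succ_mk, coeff_one,
    if_neg n.succ_ne_zero] at h
  rw [← h]
  exact sum_congr rfl fun l _ => mul_comm _ _

open PowerSeries in
theorem coeff_succ_besselQuotient_recip (m k : ℕ) :
    -coeff (k + 1) (1 + C (besselRatio m) * (X * besselQuotient (m + 1)))
      = -besselRatio m * coeff k (besselQuotient (m + 1)) := by
  rw [map_add, coeff_C_mul, coeff_succ_X_mul, coeff_one, if_neg k.succ_ne_zero]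
  ring

open PowerSeries in
theorem coeff_zero_besselQuotient_recip (m : ℕ) :
    coeff 0 (1 + C (besselRatio m) * (X * besselQuotient (m + 1))) = 1 := by
  simp

/-- The Hankel determinant of the coefficients of `besselQuotient m`, shifted by `r`. -/
noncomputable def besselHankel (r m n : ℕ) : ℚ :=
  (hankelMatrix (fun k => PowerSeries.coeff (k + r) (besselQuotient m)) n).det

theorem besselHankel_one (m n : ℕ) :
    besselHankel 1 m n = (-besselRatio m) ^ n * besselHankel 0 (m + 1) n := by
  rw [besselHankel, det_hankelMatrix_succ_of_reciprocal
    (a := fun k => PowerSeries.coeff k (1 + PowerSeries.C (besselRatio m)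
      * (PowerSeries.X * besselQuotient (m + 1))))
    (f := fun k => PowerSeries.coeff k (besselQuotient m)) (coeff_zero_besselQuotient_recip m)
    (coeff_zero_besselQuotient m) (coeff_besselQuotient_recip m)]
  simp only [coeff_succ_besselQuotient_recip, det_hankelMatrix_const_mul]
  rfl

theorem besselHankel_zero_succ (m n : ℕ) :
    besselHankel 0 m (n + 1) = (-besselRatio m) ^ n * besselHankel 1 (m + 1) n := by
  rw [besselHankel]
  simp only [add_zero]
  rw [det_hankelMatrix_of_reciprocal
    (a := fun k => PowerSeries.coeff k (1 + PowerSeries.C (besselRatio m)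
      * (PowerSeries.X * besselQuotient (m + 1))))
    (f := fun k => PowerSeries.coeff k (besselQuotient m)) (coeff_zero_besselQuotient_recip m)
    (coeff_zero_besselQuotient m) (coeff_besselQuotient_recip m)]
  simp only [coeff_succ_besselQuotient_recip, det_hankelMatrix_const_mul]
  rfl

theorem besselHankel_size_zero (r m : ℕ) : besselHankel r m 0 = 1 := by
  simp [besselHankel]

/-- Two levels of the fraction lower the size by one and raise m by two. In the ratio of consecutive
sizes the powers of -c_m and -c_{m+1} leave one factor each. -/
theorem besselHankel_zero_ratio (n : ℕ) : ∀ m, besselHankel 0 m (n + 1)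
    = (∏ i ∈ range (2 * n), -besselRatio (m + i)) * besselHankel 0 m n := by
  induction n with
  | zero => intro m; simp [besselHankel_zero_succ, besselHankel_size_zero]
  | succ n ih =>
    intro m
    rw [besselHankel_zero_succ, besselHankel_one, ih, besselHankel_zero_succ m n,
      besselHankel_one, show 2 * (n + 1) = 2 * n + 1 + 1 by ring, prod_range_succ', prod_range_succ']
    simp only [show ∀ i, m + (i + 1 + 1) = m + 1 + 1 + i from fun i => by ring]
    simp only [zero_add, add_zero]
    ring

theorem besselHankel_one_ratio (m n : ℕ) : besselHankel 1 m (n + 1)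
    = (∏ i ∈ range (2 * n + 1), -besselRatio (m + i)) * besselHankel 1 m n := by
  rw [besselHankel_one, besselHankel_one, besselHankel_zero_ratio, prod_range_succ']
  have h : ∏ i ∈ range (2 * n), -besselRatio (m + (i + 1))
      = ∏ i ∈ range (2 * n), -besselRatio (m + 1 + i) :=
    prod_congr rfl fun i _ => by rw [add_right_comm, add_assoc]
  rw [h, add_zero]
  ring

/-- The product `1 * 3 * 5 * ⋯ * (4 n + 1)`. -/
def oddProd (n : ℕ) : ℚ := ∏ i ∈ Icc 1 (2 * n), (2 * (i : ℚ) + 1)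

theorem oddProd_pos (n : ℕ) : 0 < oddProd n := prod_pos fun i _ => by positivity

theorem prod_Icc_two_mul_succ {M : Type*} [CommMonoid M] (f : ℕ → M) (n : ℕ) :
    ∏ i ∈ Icc 1 (2 * (n + 1)), f i = (∏ i ∈ Icc 1 (2 * n), f i) * f (2 * n + 1) * f (2 * n + 2) := by
  rw [show 2 * (n + 1) = 2 * n + 1 + 1 by ring, prod_Icc_succ_top (by omega),
    prod_Icc_succ_top (by omega)]

theorem oddProd_succ (n : ℕ) : oddProd (n + 1) = oddProd n * (4 * n + 3) * (4 * n + 5) := by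
  rw [oddProd, prod_Icc_two_mul_succ, ← oddProd]
  push_cast
  ring

/-- The signs cancel in pairs, and every odd factor occurs twice except the end ones, 3 and 4n + 3.
-/
theorem prod_neg_besselRatio (n : ℕ) : ∏ i ∈ range (2 * n), -besselRatio (1 + i)
    = 3 / (16 ^ n * oddProd n ^ 2 * (4 * n + 3)) := by
  induction n with
  | zero => simp [oddProd]
  | succ n ih =>
    rw [show 2 * (n + 1) = 2 * n + 1 + 1 by ring, prod_range_succ, prod_range_succ, ih,
      oddProd_succ, besselRatio, besselRatio, pow_succ]
    have := oddProd_pos n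
    push_cast
    rw [show 2 * (1 + 2 * (n : ℚ)) + 1 = 4 * n + 3 by ring,
      show 2 * (1 + 2 * (n : ℚ)) + 3 = 4 * n + 5 by ring,
      show 2 * (1 + (2 * (n : ℚ) + 1)) + 1 = 4 * n + 5 by ring,
      show 2 * (1 + (2 * (n : ℚ) + 1)) + 3 = 4 * n + 7 by ring,
      show 4 * ((n : ℚ) + 1) + 3 = 4 * n + 7 by ring]
    field_simp
    norm_num [pow_succ]

/-! ### Recurrences for the three Bernoulli determinants -/

/-- The Hankel determinant of `B (2k) / (2k)!` starting at `k = r`. -/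
noncomputable def bernoulliHankel (r n : ℕ) : ℚ :=
  (hankelMatrix (fun k => evenBernoulli (k + r)) n).det

theorem bernoulliHankel_succ (r n : ℕ) :
    bernoulliHankel (r + 1) n = (1 / 12) ^ n * besselHankel r 1 n := by
  simp only [bernoulliHankel, besselHankel, ← det_hankelMatrix_const_mul, ← add_assoc,
    evenBernoulli_succ]

theorem bernoulliHankel_size_zero (r : ℕ) : bernoulliHankel r 0 = 1 := by
  simp [bernoulliHankel]

theorem bernoulliHankel_one_succ (n : ℕ) : bernoulliHankel 1 (n + 1)
    = bernoulliHankel 1 n / (4 * 16 ^ n * oddProd n ^ 2 * (4 * n + 3)) := by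
  rw [bernoulliHankel_succ, bernoulliHankel_succ, besselHankel_zero_ratio, prod_neg_besselRatio]
  have := oddProd_pos n
  rw [pow_succ (1 / 12 : ℚ)]
  field_simp
  ring

theorem bernoulliHankel_two_succ (n : ℕ) : bernoulliHankel 2 (n + 1)
    = -bernoulliHankel 2 n / (16 ^ (n + 1) * oddProd n ^ 2 * (4 * n + 3) ^ 2 * (4 * n + 5)) := by
  rw [bernoulliHankel_succ, bernoulliHankel_succ, besselHankel_one_ratio, prod_range_succ,
    prod_neg_besselRatio, besselRatio]
  have := oddProd_pos n
  push_cast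
  rw [show 2 * (1 + 2 * (n : ℚ)) + 1 = 4 * n + 3 by ring,
    show 2 * (1 + 2 * (n : ℚ)) + 3 = 4 * n + 5 by ring]
  rw [pow_succ (1 / 12 : ℚ)]
  field_simp
  ring

theorem bernoulliHankel_one_ne_zero (n : ℕ) : bernoulliHankel 1 n ≠ 0 := by
  induction n with
  | zero => simp [bernoulliHankel_size_zero]
  | succ n ih =>
    rw [bernoulliHankel_one_succ]
    have := oddProd_pos n
    positivity

theorem bernoulliHankel_two_eq (n : ℕ) :
    bernoulliHankel 2 n = bernoulliHankel 1 n * (-1) ^ n / (4 ^ n * oddProd n) := by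
  induction n with
  | zero => simp [bernoulliHankel_size_zero, oddProd]
  | succ n ih =>
    rw [bernoulliHankel_two_succ, ih, bernoulliHankel_one_succ, oddProd_succ]
    have := oddProd_pos n
    field_simp
    ring

theorem bernoulliHankel_condensation (n : ℕ) :
    bernoulliHankel 1 (n + 2) * bernoulliHankel 3 n
      = bernoulliHankel 1 (n + 1) * bernoulliHankel 3 (n + 1) - bernoulliHankel 2 (n + 1) ^ 2 :=
  hankelMatrix_condensation (fun k => evenBernoulli (k + 1)) n (bernoulliHankel_one_ne_zero _)

/-- Since the first determinant never vanishes, condensation can be solved for the third one at n +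
1; the second enters only through its square, so its sign is lost. -/
theorem bernoulliHankel_three_eq (n : ℕ) : bernoulliHankel 3 n
    = bernoulliHankel 1 n * (n + 1) * (2 * n + 3) / (16 ^ n * oddProd n ^ 2 * (4 * n + 3)) := by
  induction n with
  | zero => simp [bernoulliHankel_size_zero, oddProd]
  | succ n ih =>
    have h0 := bernoulliHankel_one_ne_zero n
    have h1 := bernoulliHankel_one_ne_zero (n + 1)
    have h := bernoulliHankel_condensation n
    have hp := oddProd_pos n
    have hs : ((-1 : ℚ) ^ (n + 1)) ^ 2 = 1 := by rw [← pow_mul, mul_comm, pow_mul]; simp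
    have h3 : bernoulliHankel 3 (n + 1) = (bernoulliHankel 1 (n + 2) * bernoulliHankel 3 n
        + bernoulliHankel 2 (n + 1) ^ 2) / bernoulliHankel 1 (n + 1) := by
      rw [eq_div_iff h1]; linear_combination -h
    rw [h3, ih, bernoulliHankel_two_eq, div_pow, mul_pow, hs, bernoulliHankel_one_succ (n + 1),
      bernoulliHankel_one_succ n, oddProd_succ]
    push_cast
    rw [show 4 * ((n : ℚ) + 1) + 3 = 4 * n + 7 by ring]
    have h4 : (16 : ℚ) ^ n = (4 ^ n) ^ 2 := by rw [← pow_mul, mul_comm, pow_mul]; norm_num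
    rw [pow_succ 16, pow_succ 4, h4]
    field_simp
    ring

/-! ### Closed product formulas -/

/-- Raising `N` by one in a product whose exponents rise to `-1` divides it by the plain product. -/
theorem prod_Icc_zpow_succ {g : ℕ → ℚ} (hg : ∀ i, g i ≠ 0) (N : ℕ) :
    ∏ i ∈ Icc 1 (N + 1), g i ^ (-((N : ℤ) + 2 - i))
      = (∏ i ∈ Icc 1 N, g i ^ (-((N : ℤ) + 1 - i))) * (∏ i ∈ Icc 1 (N + 1), g i)⁻¹ := by
  have h : ∏ i ∈ Icc 1 N, g i ^ (-((N : ℤ) + 1 - i))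
      = ∏ i ∈ Icc 1 (N + 1), g i ^ (-((N : ℤ) + 1 - i)) := by
    rw [prod_Icc_succ_top (by omega)]
    simp
  rw [h, ← prod_inv_distrib, ← prod_mul_distrib]
  refine prod_congr rfl fun i _ => ?_
  rw [← zpow_sub_one₀ (hg i)]
  congr 1
  ring

/-- Passing from n to n + 1 lowers each exponent by 2; the index 2n starts from exponent 0, and 2n +
1 enters with exponent -1. -/
theorem prod_Icc_zpow_two_mul {g : ℕ → ℚ} (hg : ∀ i, g i ≠ 0) (n : ℕ) :
    ∏ i ∈ Icc 1 (2 * (n + 1) - 1), g i ^ (-(2 * ((n + 1 : ℕ) : ℤ) - i))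
      = (∏ i ∈ Icc 1 (2 * n - 1), g i ^ (-(2 * (n : ℤ) - i)))
        / ((∏ i ∈ Icc 1 (2 * n), g i) ^ 2 * g (2 * n + 1)) := by
  have h0 : ∏ i ∈ Icc 1 (2 * n - 1), g i ^ (-(2 * (n : ℤ) - i))
      = ∏ i ∈ Icc 1 (2 * n), g i ^ (-(2 * (n : ℤ) - i)) := by
    -- At n = 0 the truncated bound 2n - 1 is 0, so both products are empty.
    rcases n with _ | n
    · simp
    · rw [show 2 * (n + 1) - 1 = 2 * n + 1 by omega, show 2 * (n + 1) = 2 * n + 1 + 1 by omega,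
        prod_Icc_succ_top (b := 2 * n + 1) (by omega)]
      simp [mul_add, add_assoc, one_add_one_eq_two]
  have h1 : ∏ i ∈ Icc 1 (2 * n), g i ^ (-(((2 * n : ℕ) : ℤ) + 1 - i))
      = (∏ i ∈ Icc 1 (2 * n), g i ^ (-(2 * (n : ℤ) - i))) * (∏ i ∈ Icc 1 (2 * n), g i)⁻¹ := by
    rw [← prod_inv_distrib, ← prod_mul_distrib]
    refine prod_congr rfl fun i _ => ?_
    rw [← zpow_sub_one₀ (hg i)]
    congr 1
    push_cast
    ring
  have h2 := prod_Icc_zpow_succ hg (2 * n)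
  rw [h1, ← h0, prod_Icc_succ_top (f := g) (by omega)] at h2
  rw [show 2 * (n + 1) - 1 = 2 * n + 1 by omega]
  push_cast at h2 ⊢
  rw [mul_add, mul_one, h2, div_eq_mul_inv]
  simp only [mul_inv, pow_two]
  ring

theorem prod_shifted_odd (n : ℕ) :
    ∏ i ∈ Icc 1 (2 * n), (2 * (i : ℚ) + 3) = oddProd n * (4 * n + 3) / 3 := by
  induction n with
  | zero => simp [oddProd]
  | succ n ih =>
    rw [prod_Icc_two_mul_succ, ih, oddProd_succ]
    push_cast
    ring

theorem bernoulliHankel_one_eq_prod (n : ℕ) : bernoulliHankel 1 n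
    = (4 : ℚ) ^ (-(n : ℤ) ^ 2) *
        ∏ i ∈ Icc 1 (2 * n - 1), (2 * (i : ℚ) + 1) ^ (-(2 * (n : ℤ) - (i : ℤ))) := by
  induction n with
  | zero => simp [bernoulliHankel_size_zero]
  | succ n ih =>
    rw [bernoulliHankel_one_succ, ih,
      prod_Icc_zpow_two_mul (g := fun i => 2 * (i : ℚ) + 1) (fun i => by positivity), ← oddProd,
      show -((n + 1 : ℕ) : ℤ) ^ 2 = -(n : ℤ) ^ 2 - ((1 + 2 * n : ℕ) : ℤ) by push_cast; ring,
      zpow_sub₀ (by norm_num), zpow_natCast, pow_add, pow_mul]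
    push_cast
    rw [show 2 * (2 * (n : ℚ) + 1) + 1 = 4 * n + 3 by ring]
    norm_num
    field_simp

theorem bernoulliHankel_two_eq_prod (n : ℕ) : bernoulliHankel 2 n
    = (-1 : ℚ) ^ n * (4 : ℚ) ^ (-(n : ℤ) ^ 2 - (n : ℤ)) * (9 : ℚ) ^ (-(n : ℤ)) *
        ∏ i ∈ Icc 1 (2 * n - 1), (2 * (i : ℚ) + 3) ^ (-(2 * (n : ℤ) - (i : ℤ))) := by
  induction n with
  | zero => simp [bernoulliHankel_size_zero]
  | succ n ih =>
    rw [bernoulliHankel_two_succ, ih,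
      prod_Icc_zpow_two_mul (g := fun i => 2 * (i : ℚ) + 3) (fun i => by positivity),
      prod_shifted_odd,
      show -((n + 1 : ℕ) : ℤ) ^ 2 - ((n + 1 : ℕ) : ℤ)
        = -(n : ℤ) ^ 2 - (n : ℤ) - ((2 * (n + 1) : ℕ) : ℤ) by push_cast; ring,
      zpow_sub₀ (a := (4 : ℚ)) (by norm_num) (-(n : ℤ) ^ 2 - (n : ℤ)), zpow_natCast, pow_mul,
      show -((n + 1 : ℕ) : ℤ) = -(n : ℤ) - 1 by push_cast; ring, zpow_sub_one₀ (by norm_num)]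
    push_cast
    rw [show 2 * (2 * (n : ℚ) + 1) + 3 = 4 * n + 5 by ring]
    have := oddProd_pos n
    norm_num
    field_simp
    ring

theorem bernoulliHankel_three_eq_prod (n : ℕ) : bernoulliHankel 3 n
    = (4 : ℚ) ^ (-(n : ℤ) ^ 2 - 2 * (n : ℤ)) * ((n : ℚ) + 1) * (2 * (n : ℚ) + 3) *
        ∏ i ∈ Icc 1 (2 * n + 1), (2 * (i : ℚ) + 1) ^ (-(2 * (n : ℤ) + 2 - (i : ℤ))) := by
  -- The product in the third formula is that of the first with n + 1 in place of n.
  have h := prod_Icc_zpow_two_mul (g := fun i => 2 * (i : ℚ) + 1) (fun i => by positivity) n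
  rw [show 2 * (n + 1) - 1 = 2 * n + 1 by omega, ← oddProd] at h
  push_cast at h
  rw [mul_add 2 (n : ℤ), mul_one] at h
  rw [bernoulliHankel_three_eq, h, bernoulliHankel_one_eq_prod,
    show 2 * (n : ℤ) = ((2 * n : ℕ) : ℤ) by push_cast; ring, zpow_sub₀ (by norm_num), zpow_natCast,
    pow_mul, show 2 * (2 * (n : ℚ) + 1) + 1 = 4 * n + 3 by ring]
  have := oddProd_pos n
  norm_num
  field_simp

theorem bernoulliHankel_eq_det (r n : ℕ) : bernoulliHankel r n
    = (Matrix.of fun i j : Fin n =>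
        bernoulli (2 * (i : ℕ) + 2 * (j : ℕ) + 2 * r) /
          ((2 * (i : ℕ) + 2 * (j : ℕ) + 2 * r).factorial : ℚ)).det := by
  simp only [bernoulliHankel, hankelMatrix, evenBernoulli, mul_add]

theorem theoremA (n : ℕ) :
    (Matrix.of fun i j : Fin n =>
        bernoulli (2 * (i : ℕ) + 2 * (j : ℕ) + 2) /
          ((2 * (i : ℕ) + 2 * (j : ℕ) + 2).factorial : ℚ)).det
      = (4 : ℚ) ^ (-(n : ℤ) ^ 2) *
        ∏ i ∈ Finset.Icc 1 (2 * n - 1), (2 * (i : ℚ) + 1) ^ (-(2 * (n : ℤ) - (i : ℤ))) ∧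
    (Matrix.of fun i j : Fin n =>
        bernoulli (2 * (i : ℕ) + 2 * (j : ℕ) + 4) /
          ((2 * (i : ℕ) + 2 * (j : ℕ) + 4).factorial : ℚ)).det
      = (-1 : ℚ) ^ n * (4 : ℚ) ^ (-(n : ℤ) ^ 2 - (n : ℤ)) * (9 : ℚ) ^ (-(n : ℤ)) *
        ∏ i ∈ Finset.Icc 1 (2 * n - 1), (2 * (i : ℚ) + 3) ^ (-(2 * (n : ℤ) - (i : ℤ))) ∧
    (Matrix.of fun i j : Fin n =>
        bernoulli (2 * (i : ℕ) + 2 * (j : ℕ) + 6) /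
          ((2 * (i : ℕ) + 2 * (j : ℕ) + 6).factorial : ℚ)).det
      = (4 : ℚ) ^ (-(n : ℤ) ^ 2 - 2 * (n : ℤ)) * ((n : ℚ) + 1) * (2 * (n : ℚ) + 3) *
        ∏ i ∈ Finset.Icc 1 (2 * n + 1), (2 * (i : ℚ) + 1) ^ (-(2 * (n : ℤ) + 2 - (i : ℤ))) :=
  ⟨(bernoulliHankel_eq_det 1 n).symm.trans (bernoulliHankel_one_eq_prod n),
    (bernoulliHankel_eq_det 2 n).symm.trans (bernoulliHankel_two_eq_prod n),
    (bernoulliHankel_eq_det 3 n).symm.trans (bernoulliHankel_three_eq_prod n)⟩
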